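/- Let $\mathcal{A}$ be a unital $C^*$-algebra with center $Z(\mathcal{A})$, and let $H_{\mathcal{A}}$ be the standard Hilbert module over $\mathcal{A}$, that is, the $\mathcal{A}$-module of all sequences $x=(x_k)_{k\ge 0}$ in $\mathcal{A}$ for which $\sum_k x_k x_k^*$ converges in norm, with the $\mathcal{A}$-valued inner product $\langle x,y\rangle=\sum_k y_k x_k^*$ and the norm $\|x\|=\|\langle x,x\rangle\|^{1/2}$ (we use left Hilbert modules). Let $B^a(H_{\mathcal{A}})$ denote the set of all bounded adjointable $\mathcal{A}$-linear operators on $H_{\mathcal{A}}$. Let $E$ be $H_{\mathcal{A}}$ or the Hilbert module direct sum $H_{\mathcal{A}}\oplus H_{\mathcal{A}}$. A bounded $\mathcal{A}$-linear operator $T$ on $E$ is called $\mathcal{A}$-Fredholm if it is adjointable and there are closed submodules $M_1,N_1,M_2,N_2$ of $E$ such that $E=M_1\tilde\oplus N_1=M_2\tilde\oplus N_2$ (direct sums, not necessarily orthogonal), $N_1$ and $N_2$ are finitely generated, $T$ restricts to an isomorphism (an $\mathcal{A}$-linear homeomorphism) of $M_1$ onto $M_2$, and $T(N_1)\subseteq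 N_2$. For adjointable $T$ on $E$ put $$\sigma_e^{\mathcal{A}}(T)=\{\alpha\in Z(\mathcal{A}) : T-\alpha I \text{ is not } \mathcal{A}\text{-Fredholm}\},$$ where $\alpha I$ is the operator $x\mapsto \alpha x$. For all $F,C,D\in B^a(H_{\mathcal{A}})$, the operator matrix $$M_C^{\mathcal{A}}=\begin{pmatrix} F & C\\ 0 & D\end{pmatrix} : H_{\mathcal{A}}\oplus H_{\mathcal{A}}\to H_{\mathcal{A}}\oplus H_{\mathcal{A}}$$ satisfies $$\sigma_e^{\mathcal{A}}(M_C^{\mathcal{A}})\subseteq \sigma_e^{\mathcal{A}}(F)\cup\sigma_e^{\mathcal{A}}(D).$$ -/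

import Mathlib

open scoped InnerProductSpace WithCStarModule

noncomputable section

/-! Hilbert modules follow Mathlib's convention: they are left `A`-modules, and the `A`-valued inner
product `⟪x, y⟫_A` is `A`-linear in its second variable, so that `⟪x, y⟫_A = y * star x` on `A`. -/

/-! ### The standard Hilbert module -/

/-- In a C⋆-algebra, a series of nonnegative terms dominated by a summable series is summable. -/
theorem summable_of_nonneg_of_le_cstar {A : Type*} [CStarAlgebra A] [PartialOrder A]
    [StarOrderedRing A] {f g : ℕ → A} (hf : ∀ k, 0 ≤ f k) (hfg : ∀ k, f k ≤ g k)
    (hg : Summable g) : Summable f := by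
  rw [summable_iff_vanishing_norm] at hg ⊢
  intro ε hε
  obtain ⟨s, hs⟩ := hg ε hε
  refine ⟨s, fun t ht => lt_of_le_of_lt ?_ (hs t ht)⟩
  exact CStarAlgebra.norm_le_norm_of_nonneg_of_le (Finset.sum_nonneg fun k _ => hf k)
    (Finset.sum_le_sum fun k _ => hfg k)

theorem summable_add_mul_star_add {A : Type*} [CStarAlgebra A] [PartialOrder A]
    [StarOrderedRing A] {x y : ℕ → A} (hx : Summable fun k => x k * star (x k))
    (hy : Summable fun k => y k * star (y k)) :
    Summable fun k => (x k + y k) * star (x k + y k) := by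
  refine summable_of_nonneg_of_le_cstar (fun k => mul_star_self_nonneg _) (fun k => ?_)
    ((hx.add hx).add (hy.add hy))
  have h := mul_star_self_nonneg (x k - y k)
  rw [← sub_nonneg]
  convert h using 1
  simp only [star_add, star_sub]
  noncomm_ring

/-- The sequences `x : ℕ → A` for which `∑ x k * star (x k)` converges in norm, as an `A`-submodule
of all sequences.  (For nonnegative terms, convergence of the partial sums and unconditional
summability are the same.) -/
def standardSubmodule (A : Type*) [CStarAlgebra A] [PartialOrder A] [StarOrderedRing A] :
    Submodule A (ℕ → A) where
  carrier := {x | Summable fun k => x k * star (x k)}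
  add_mem' := fun hx hy => summable_add_mul_star_add hx hy
  zero_mem' := by simp
  smul_mem' := fun a x hx => by
    have h := Summable.mul_left a (Summable.mul_right (star a) hx)
    refine h.congr fun k => ?_
    simp [mul_assoc]

/-- The standard Hilbert module `H_A` over the C⋆-algebra `A`. -/
def StandardModule (A : Type*) [CStarAlgebra A] [PartialOrder A] [StarOrderedRing A] : Type _ :=
  standardSubmodule A

namespace StandardModule

variable {A : Type*} [CStarAlgebra A] [PartialOrder A] [StarOrderedRing A]

instance instAddCommGroup : AddCommGroup (StandardModule A) :=
  inferInstanceAs (AddCommGroup (standardSubmodule A))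

instance instModule : Module A (StandardModule A) :=
  inferInstanceAs (Module A (standardSubmodule A))

instance instModuleComplex : Module ℂ (StandardModule A) :=
  inferInstanceAs (Module ℂ (standardSubmodule A))

/-- The `k`-th coordinate. -/
def coord (x : StandardModule A) (k : ℕ) : A := x.1 k

theorem coord_ext {x y : StandardModule A} (h : ∀ k, x.coord k = y.coord k) : x = y :=
  Subtype.ext (funext h)

@[simp] theorem coord_zero (k : ℕ) : (0 : StandardModule A).coord k = 0 := rfl

@[simp] theorem coord_add (x y : StandardModule A) (k : ℕ) :
    (x + y).coord k = x.coord k + y.coord k := rfl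

@[simp] theorem coord_smul (a : A) (x : StandardModule A) (k : ℕ) :
    (a • x).coord k = a * x.coord k := rfl

@[simp] theorem coord_smul_complex (z : ℂ) (x : StandardModule A) (k : ℕ) :
    (z • x).coord k = z • x.coord k := rfl

theorem summable_self (x : StandardModule A) : Summable fun k => x.coord k * star (x.coord k) :=
  x.2

/-- The series defining the inner product converges, by polarization. -/
theorem summable_inner (x y : StandardModule A) :
    Summable fun k => y.coord k * star (x.coord k) := by
  have h : ∀ z : ℂ, Summable fun k =>
      (y.coord k + z • x.coord k) * star (y.coord k + z • x.coord k) :=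
    fun z => summable_self (y + z • x)
  have h1 := ((h 1).sub (h (-1))).const_smul (4⁻¹ : ℂ)
  have h2 := ((h Complex.I).sub (h (-Complex.I))).const_smul (4⁻¹ * Complex.I : ℂ)
  refine (h1.add h2).congr fun k => ?_
  generalize x.coord k = a
  generalize y.coord k = b
  simp only [star_add, star_smul, add_mul, mul_add, smul_mul_assoc, mul_smul_comm, smul_smul,
    smul_sub, smul_add]
  simp
  match_scalars <;> simp [mul_assoc]
  norm_num

instance instInner : Inner A (StandardModule A) where
  inner x y := ∑' k, y.coord k * star (x.coord k)

theorem inner_def (x y : StandardModule A) :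
    ⟪x, y⟫_A = ∑' k, y.coord k * star (x.coord k) := rfl

instance instNorm : Norm (StandardModule A) where
  norm x := √‖⟪x, x⟫_A‖

instance instCStarModule : CStarModule A (StandardModule A) where
  inner_add_right {x y z} := by
    simp only [inner_def, coord_add, add_mul]
    exact (summable_inner x y).tsum_add (summable_inner x z)
  inner_self_nonneg {x} := tsum_nonneg fun k => mul_star_self_nonneg _
  inner_self {x} := by
    refine ⟨fun h => ?_, fun h => by simp [h, inner_def]⟩
    refine coord_ext fun k => ?_
    have h0 : x.coord k * star (x.coord k) ≤ 0 := by
      rw [← h]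
      exact (summable_self x).le_tsum k fun j _ => mul_star_self_nonneg _
    exact (CStarRing.mul_star_self_eq_zero_iff _).1
      (le_antisymm h0 (mul_star_self_nonneg (x.coord k)))
  inner_op_smul_right {a x y} := by
    simp only [inner_def, coord_smul, mul_assoc]
    exact (summable_inner x y).tsum_mul_left a
  inner_smul_right_complex {z x y} := by
    simp only [inner_def, coord_smul_complex, smul_mul_assoc]
    exact (summable_inner x y).tsum_const_smul z
  star_inner x y := by
    simp only [inner_def]
    rw [tsum_star]
    simp
  norm_eq_sqrt_norm_inner_self x := rfl

instance instNormedAddCommGroup : NormedAddCommGroup (StandardModule A) :=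
  CStarModule.normedAddCommGroup A

instance instNormedSpace : NormedSpace ℂ (StandardModule A) :=
  .ofCore (CStarModule.normedSpaceCore A)

end StandardModule

/-! ### Adjointable and Fredholm operators -/

section Operators

variable (A : Type*) [CStarAlgebra A] [PartialOrder A]
variable {E : Type*} [NormedAddCommGroup E] [Module ℂ E] [Module A E] [CStarModule A E]
variable {E' : Type*} [NormedAddCommGroup E'] [Module ℂ E'] [Module A E'] [CStarModule A E']

/-- A bounded `A`-linear operator is adjointable if it has an adjoint with respect to the
`A`-valued inner products. -/
def IsAdjointable (T : E →L[A] E') : Prop :=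
  ∃ S : E' →L[A] E, ∀ x y, ⟪T x, y⟫_A = ⟪x, S y⟫_A

/-- `A`-Fredholm operators on a Hilbert module `E`: adjointable operators which are diagonal with
respect to decompositions `E = M₁ ⊕ N₁` and `E = M₂ ⊕ N₂` of the domain and the range into closed
submodules (not necessarily orthogonal), where `N₁` and `N₂` are finitely generated, and the
operator restricts to an isomorphism of `M₁` onto `M₂`. -/
def IsAFredholm (T : E →L[A] E) : Prop :=
  IsAdjointable A T ∧
    ∃ M₁ N₁ M₂ N₂ : Submodule A E,
      IsClosed (M₁ : Set E) ∧ IsClosed (N₁ : Set E) ∧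
      IsClosed (M₂ : Set E) ∧ IsClosed (N₂ : Set E) ∧
      IsCompl M₁ N₁ ∧ IsCompl M₂ N₂ ∧ N₁.FG ∧ N₂.FG ∧
      (∃ e : M₁ ≃L[A] M₂, ∀ x : M₁, (e x : E) = T x) ∧
      ∀ x ∈ N₁, T x ∈ N₂

theorem norm_smul_le_cstarModule (a : A) (x : E) : ‖a • x‖ ≤ ‖a‖ * ‖x‖ := by
  refine abs_le_of_sq_le_sq' ?_ (by positivity) |>.2
  rw [mul_pow, CStarModule.norm_sq_eq A (x := a • x), CStarModule.norm_sq_eq A (x := x)]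
  simp only [CStarModule.inner_op_smul_right, CStarModule.inner_op_smul_left]
  calc ‖a * (⟪x, x⟫_A * star a)‖ ≤ ‖a‖ * (‖⟪x, x⟫_A‖ * ‖star a‖) :=
        (norm_mul_le _ _).trans (by gcongr; exact norm_mul_le _ _)
    _ = ‖a‖ ^ 2 * ‖⟪x, x⟫_A‖ := by rw [norm_star]; ring

/-- The operator `x ↦ α • x`, for `α` in the center of `A`. -/
def centralScalar (E : Type*) [NormedAddCommGroup E] [Module ℂ E] [Module A E] [CStarModule A E]
    (α : Subalgebra.center ℂ A) : E →L[A] E where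
  toFun x := (α : A) • x
  map_add' := smul_add _
  map_smul' a x := by
    have h : (α : A) * a = a * α := (Subalgebra.mem_center_iff.1 α.2 a).symm
    simp only [smul_smul, h, RingHom.id_apply]
  cont := by
    exact AddMonoidHomClass.continuous_of_bound (DistribSMul.toAddMonoidHom E (α : A)) ‖(α : A)‖
      fun x => norm_smul_le_cstarModule A (α : A) x

@[simp] theorem centralScalar_apply (α : Subalgebra.center ℂ A) (x : E) :
    centralScalar A E α x = (α : A) • x := rfl

/-- The generalized essential spectrum, a subset of the center `Z(A)`. -/
def essentialSpectrum (T : E →L[A] E) : Set (Subalgebra.center ℂ A) :=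
  {α | ¬ IsAFredholm A (T - centralScalar A E α)}

end Operators

section OperatorMatrix

variable {A : Type*} [CStarAlgebra A]
variable {E : Type*} [NormedAddCommGroup E] [Module A E]
variable {E' : Type*} [NormedAddCommGroup E'] [Module A E']

/-- The operator matrix `[F C; 0 D]` on the Hilbert module direct sum `E ⊕ E'`. -/
def upperTriangular (F : E →L[A] E) (C : E' →L[A] E) (D : E' →L[A] E') :
    C⋆ᵐᵒᵈ(A, E × E') →L[A] C⋆ᵐᵒᵈ(A, E × E') :=
  ((WithCStarModule.equivL A (A := A) (E := E × E')).symm : E × E' →L[A] C⋆ᵐᵒᵈ(A, E × E')) ∘L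
    ((F.coprod C).prod (D ∘L ContinuousLinearMap.snd A E E')) ∘L
    (WithCStarModule.equivL A (A := A) (E := E × E') : C⋆ᵐᵒᵈ(A, E × E') →L[A] E × E')

theorem upperTriangular_apply (F : E →L[A] E) (C : E' →L[A] E) (D : E' →L[A] E') (x : E) (y : E') :
    upperTriangular F C D ((WithCStarModule.equiv A (E × E')).symm (x, y)) =
      (WithCStarModule.equiv A (E × E')).symm (F x + C y, D y) := rfl

end OperatorMatrix

end

open scoped InnerProductSpace WithCStarModule

noncomputable section

/-! ### Completeness of the standard module -/

namespace StandardModule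

variable {A : Type*} [CStarAlgebra A] [PartialOrder A] [StarOrderedRing A]

/-! An adjointable `T` is Fredholm exactly when it has a bounded `G` with `G T G = G` such that `1 -
G T` and `1 - T G` have finitely generated range (`IsAFredholm.exists_isFredholmInverse`,
`IsFredholmInverse.isAFredholm`); `G` itself need not be adjointable. In this form the result is
matrix algebra: if `G` and `H` serve for `F` and `D`, then `[G, -GCH; 0, H]`, the formal inverse of
a triangular matrix, serves for `[F, C; 0, D]`, whatever `C` is
(`IsFredholmInverse.upperTriangular`). Applied to `F - α` and `D - α`, this gives the inclusion of
spectra. Completeness of the standard module makes the projections of a closed decomposition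
bounded, hence also `G`. -/

instance instIsScalarTower : IsScalarTower ℂ A (StandardModule A) where
  smul_assoc z a x := coord_ext fun k => smul_mul_assoc z a (x.coord k)

theorem norm_sq_eq_norm_tsum (x : StandardModule A) :
    ‖x‖ ^ 2 = ‖∑' k, x.coord k * star (x.coord k)‖ :=
  CStarModule.norm_sq_eq A

theorem norm_sum_coord_le (x : StandardModule A) (s : Finset ℕ) :
    ‖∑ k ∈ s, x.coord k * star (x.coord k)‖ ≤ ‖x‖ ^ 2 := by
  rw [norm_sq_eq_norm_tsum]
  exact CStarAlgebra.norm_le_norm_of_nonneg_of_le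
    (Finset.sum_nonneg fun k _ => mul_star_self_nonneg _)
    (x.summable_self.sum_le_tsum s fun k _ => mul_star_self_nonneg _)

theorem norm_coord_le (x : StandardModule A) (k : ℕ) : ‖x.coord k‖ ≤ ‖x‖ := by
  have h := x.norm_sum_coord_le {k}
  rw [Finset.sum_singleton, CStarRing.norm_self_mul_star, ← sq] at h
  exact (sq_le_sq₀ (norm_nonneg _) (norm_nonneg _)).1 h

theorem norm_sq_le_of_norm_sum_le {x : StandardModule A} {c : ℝ}
    (h : ∀ s : Finset ℕ, ‖∑ k ∈ s, x.coord k * star (x.coord k)‖ ≤ c) : ‖x‖ ^ 2 ≤ c := by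
  rw [norm_sq_eq_norm_tsum]
  exact le_of_tendsto' (x.summable_self.hasSum.norm) h

/-- A sequence which is, uniformly over finite sets of indices, a limit of elements of the standard
module lies in the standard module. -/
theorem mem_standardSubmodule_of_approx {x : ℕ → A}
    (h : ∀ ε > 0, ∃ y : StandardModule A, ∀ s : Finset ℕ,
      ‖∑ k ∈ s, (x k - y.coord k) * star (x k - y.coord k)‖ ≤ ε) :
    x ∈ standardSubmodule A := by
  change Summable fun k => x k * star (x k)
  rw [summable_iff_vanishing_norm]
  intro ε hε
  obtain ⟨y, hy⟩ := h (ε / 8) (by positivity)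
  obtain ⟨s, hs⟩ := summable_iff_vanishing_norm.1 y.summable_self (ε / 8) (by positivity)
  refine ⟨s, fun t ht => ?_⟩
  set u := ∑ k ∈ t, (x k - y.coord k) * star (x k - y.coord k)
  set v := ∑ k ∈ t, y.coord k * star (y.coord k)
  have hle : ∑ k ∈ t, x k * star (x k) ≤ (u + u) + (v + v) := by
    simp only [u, v, ← Finset.sum_add_distrib]
    refine Finset.sum_le_sum fun k _ => ?_
    -- With `d = x - y`, the difference `2 d d* + 2 y y* - x x*` is the square `(x - 2y)(x - 2y)*`.
    have h0 := mul_star_self_nonneg (x k - y.coord k - y.coord k)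
    rw [← sub_nonneg]
    convert h0 using 1
    simp only [star_sub]
    noncomm_ring
  have hu : ‖u‖ ≤ ε / 8 := hy t
  have hv : ‖v‖ < ε / 8 := hs t ht
  calc ‖∑ k ∈ t, x k * star (x k)‖ ≤ ‖(u + u) + (v + v)‖ :=
        CStarAlgebra.norm_le_norm_of_nonneg_of_le
          (Finset.sum_nonneg fun k _ => mul_star_self_nonneg _) hle
    _ ≤ (‖u‖ + ‖u‖) + (‖v‖ + ‖v‖) :=
        (norm_add_le _ _).trans (add_le_add (norm_add_le _ _) (norm_add_le _ _))
    _ < ε := by linarith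

instance instCompleteSpace : CompleteSpace (StandardModule A) := by
  refine Metric.complete_of_cauchySeq_tendsto fun u hu => ?_
  have hcoord : ∀ k, ∃ a, Filter.Tendsto (fun n => (u n).coord k) Filter.atTop (nhds a) := by
    refine fun k => cauchySeq_tendsto_of_complete (Metric.cauchySeq_iff.2 fun ε hε => ?_)
    obtain ⟨N, hN⟩ := Metric.cauchySeq_iff.1 hu ε hε
    refine ⟨N, fun m hm n hn => lt_of_le_of_lt ?_ (hN m hm n hn)⟩
    rw [dist_eq_norm, dist_eq_norm]
    exact (u m - u n).norm_coord_le k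
  choose x hx using hcoord
  -- Only coordinatewise limits are available, so `m → ∞` is taken in each finite sum; the bound
  -- does not depend on `s`.
  have key : ∀ ε > 0, ∃ N, ∀ n ≥ N, ∀ s : Finset ℕ,
      ‖∑ k ∈ s, (x k - (u n).coord k) * star (x k - (u n).coord k)‖ ≤ ε ^ 2 := by
    intro ε hε
    obtain ⟨N, hN⟩ := Metric.cauchySeq_iff.1 hu ε hε
    refine ⟨N, fun n hn s => ?_⟩
    have hlim : Filter.Tendsto
        (fun m => ‖∑ k ∈ s, (u m - u n).coord k * star ((u m - u n).coord k)‖) Filter.atTop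
        (nhds ‖∑ k ∈ s, (x k - (u n).coord k) * star (x k - (u n).coord k)‖) :=
      (tendsto_finsetSum s fun k _ =>
        ((hx k).sub_const _).mul ((hx k).sub_const _).star).norm
    refine le_of_tendsto hlim (Filter.eventually_atTop.2 ⟨N, fun m hm => ?_⟩)
    refine ((u m - u n).norm_sum_coord_le s).trans ?_
    have := hN m hm n hn
    rw [dist_eq_norm] at this
    gcongr
  have hmem : x ∈ standardSubmodule A := by
    refine mem_standardSubmodule_of_approx fun ε hε => ?_
    obtain ⟨N, hN⟩ := key (√ε) (Real.sqrt_pos.2 hε)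
    refine ⟨u N, fun s => ?_⟩
    simpa only [Real.sq_sqrt hε.le] using hN N le_rfl s
  let x' : StandardModule A := ⟨x, hmem⟩
  refine ⟨x', Metric.tendsto_atTop.2 fun ε hε => ?_⟩
  obtain ⟨N, hN⟩ := key (ε / 2) (by positivity)
  refine ⟨N, fun n hn => ?_⟩
  rw [dist_comm, dist_eq_norm]
  have h : ‖x' - u n‖ ^ 2 ≤ (ε / 2) ^ 2 := norm_sq_le_of_norm_sum_le (hN n hn)
  linarith [(sq_le_sq₀ (norm_nonneg _) (by positivity)).1 h]

end StandardModule

/-! ### Fredholm operators and generalized inverses -/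

section GeneralizedInverse

/-- `G` is an outer inverse of `T` modulo finitely generated submodules. -/
structure IsFredholmInverse {A E : Type*} [Ring A] [AddCommGroup E] [TopologicalSpace E]
    [Module A E] (T G : E →L[A] E) : Prop where
  outer : ∀ x, G (T (G x)) = G x
  fg_left : (LinearMap.id - (G ∘L T : E →L[A] E).toLinearMap).range.FG
  fg_right : (LinearMap.id - (T ∘L G : E →L[A] E).toLinearMap).range.FG

variable (A : Type*) [CStarAlgebra A]

/-- Closed algebraic complements in a Banach space with a compatible action of a complex algebra
are topological complements. -/
theorem isTopCompl_of_isCompl_of_isClosed {E : Type*} [NormedAddCommGroup E] [NormedSpace ℂ E]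
    [Module A E] [IsScalarTower ℂ A E] [CompleteSpace E] {M N : Submodule A E}
    (h : IsCompl M N) (hM : IsClosed (M : Set E)) (hN : IsClosed (N : Set E)) :
    M.IsTopCompl N := by
  -- Over `ℂ` the Banach space theorem applies, and the complex projection is the same map as the
  -- `A`-linear one.
  have h' : IsCompl (M.restrictScalars ℂ) (N.restrictScalars ℂ) := by
    rw [isCompl_iff, Submodule.disjoint_def, codisjoint_iff_le_sup]
    refine ⟨fun x hx hy => Submodule.disjoint_def.1 h.disjoint x hx hy, fun x _ => ?_⟩
    obtain ⟨y, hy, z, hz, rfl⟩ := Submodule.mem_sup.1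
      (h.sup_eq_top ▸ Submodule.mem_top : x ∈ M ⊔ N)
    exact Submodule.add_mem_sup (show y ∈ M.restrictScalars ℂ from hy)
      (show z ∈ N.restrictScalars ℂ from hz)
  refine ⟨h, ?_⟩
  refine (Submodule.IsCompl.isTopCompl_of_isClosed h' hM hN).continuous_projection.congr
    fun x => ?_
  obtain ⟨y, hy, z, hz, rfl⟩ := Submodule.mem_sup.1
    (h.sup_eq_top ▸ Submodule.mem_top : x ∈ M ⊔ N)
  rw [map_add, map_add, Submodule.projection_apply_of_mem_left h hy,
    (Submodule.projection_apply_eq_zero_iff h).2 hz,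
    Submodule.projection_apply_of_mem_left h' hy,
    (Submodule.projection_apply_eq_zero_iff h').2 hz]

variable {A} [PartialOrder A] {E : Type*} [NormedAddCommGroup E]

/-- `G` inverts `T` from `M₂` back to `M₁` and kills `N₂`. Since `T` maps `N₁` into `N₂`, `G T` and
`T G` are the projections along `N₁` and `N₂`. -/
theorem IsAFredholm.exists_isFredholmInverse [NormedSpace ℂ E] [Module A E] [CStarModule A E]
    [IsScalarTower ℂ A E] [CompleteSpace E] {T : E →L[A] E} (hT : IsAFredholm A T) :
    ∃ G : E →L[A] E, IsFredholmInverse T G := by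
  obtain ⟨-, M₁, N₁, M₂, N₂, hM₁, hN₁, hM₂, hN₂, h₁, h₂, fg₁, fg₂, ⟨e, he⟩, hTN⟩ := hT
  have t₂ := isTopCompl_of_isCompl_of_isClosed A h₂ hM₂ hN₂
  let G : E →L[A] E := M₁.subtypeL ∘L (e.symm : M₂ →L[A] M₁) ∘L M₂.projectionOntoL N₂ t₂
  have hGmem : ∀ x, G x ∈ M₁ := fun x => (e.symm (M₂.projectionOntoL N₂ t₂ x)).2
  have hGN : ∀ x ∈ N₂, G x = 0 := fun x hx => by
    have : M₂.projectionOntoL N₂ t₂ x = 0 :=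
      (Submodule.projectionOntoL_apply_eq_zero_iff t₂).2 hx
    simp [G, this]
  have hGT : ∀ x ∈ M₁, G (T x) = x := fun x hx => by
    have : M₂.projectionOntoL N₂ t₂ (T x) = e ⟨x, hx⟩ := by
      rw [← he ⟨x, hx⟩]
      exact Submodule.projectionOntoL_apply_left t₂ _
    simp [G, this]
  have hTM : ∀ x ∈ M₁, T x ∈ M₂ := fun x hx => he ⟨x, hx⟩ ▸ (e ⟨x, hx⟩).2
  have hTG : ∀ x ∈ M₂, T (G x) = x := fun x hx => by
    obtain ⟨y, hy⟩ := e.surjective ⟨x, hx⟩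
    have hxy : x = T y := by rw [← he y, hy]
    rw [hxy, hGT y y.2]
  refine ⟨G, fun x => hGT _ (hGmem x), ?_, ?_⟩
  · convert fg₁
    ext x
    constructor
    · rintro ⟨y, rfl⟩
      obtain ⟨m, hm, n, hn, rfl⟩ := Submodule.mem_sup.1
        (h₁.sup_eq_top ▸ Submodule.mem_top : y ∈ M₁ ⊔ N₁)
      simpa [hGT m hm, hGN _ (hTN n hn)] using hn
    · exact fun hx => ⟨x, by simp [hGN _ (hTN x hx)]⟩
  · convert fg₂
    ext x
    constructor
    · rintro ⟨y, rfl⟩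
      obtain ⟨m, hm, n, hn, rfl⟩ := Submodule.mem_sup.1
        (h₂.sup_eq_top ▸ Submodule.mem_top : y ∈ M₂ ⊔ N₂)
      simpa [hTG m hm, hGN n hn] using hn
    · exact fun hx => ⟨x, by simp [hGN x hx]⟩

/-- `G T` and `T G` are continuous idempotents; their ranges and kernels give the two
decompositions, and `T` and `G` are mutually inverse between the ranges. -/
theorem IsFredholmInverse.isAFredholm [Module ℂ E] [Module A E] [CStarModule A E]
    {T G : E →L[A] E} (hG : IsFredholmInverse T G) (hT : IsAdjointable A T) :
    IsAFredholm A T := by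
  have hP : IsIdempotentElem (G ∘L T) := by
    ext x
    exact hG.outer (T x)
  have hQ : IsIdempotentElem (T ∘L G) := by
    ext x
    exact congrArg T (hG.outer x)
  have tP := ContinuousLinearMap.IsIdempotentElem.isTopCompl hP
  have tQ := ContinuousLinearMap.IsIdempotentElem.isTopCompl hQ
  have ker_eq : ∀ {P : E →L[A] E}, IsIdempotentElem P →
      P.ker = (LinearMap.id - P.toLinearMap).range := by
    intro P hP
    ext x
    constructor
    · intro hx
      exact ⟨x, by simpa using hx⟩
    · rintro ⟨y, rfl⟩
      have : P (P y) = P y := congrArg (fun R : E →L[A] E => R y) hP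
      simp [this]
  have hGT : ∀ x ∈ (G ∘L T).range, G (T x) = x := by
    rintro _ ⟨y, rfl⟩
    exact hG.outer (T y)
  have hTG : ∀ x ∈ (T ∘L G).range, T (G x) = x := by
    rintro _ ⟨y, rfl⟩
    exact congrArg T (hG.outer y)
  have mapT : ∀ x ∈ (G ∘L T).range, T x ∈ (T ∘L G).range :=
    fun x hx => ⟨T x, congrArg T (hGT x hx)⟩
  have mapG : ∀ x ∈ (T ∘L G).range, G x ∈ (G ∘L T).range :=
    fun x hx => ⟨G x, hG.outer x⟩
  let e : (G ∘L T).range ≃L[A] (T ∘L G).range :=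
    ContinuousLinearEquiv.equivOfInverse
      ((T ∘L (G ∘L T).range.subtypeL).codRestrict _ fun x => mapT x x.2)
      ((G ∘L (T ∘L G).range.subtypeL).codRestrict _ fun x => mapG x x.2)
      (fun x => Subtype.ext (hGT x x.2)) (fun x => Subtype.ext (hTG x x.2))
  refine ⟨hT, (G ∘L T).range, (G ∘L T).ker, (T ∘L G).range, (T ∘L G).ker,
    tP.symm.isClosed', tP.isClosed', tQ.symm.isClosed', tQ.isClosed', tP.isCompl, tQ.isCompl,
    ker_eq hP ▸ hG.fg_left, ker_eq hQ ▸ hG.fg_right, ⟨e, fun x => rfl⟩, fun x hx => ?_⟩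
  have hx' : G (T x) = 0 := hx
  change T (G (T x)) = 0
  rw [hx', map_zero]

end GeneralizedInverse

/-! ### Upper triangular operator matrices -/

section OperatorMatrix

variable {A : Type*} [CStarAlgebra A]
variable {E : Type*} [NormedAddCommGroup E] [Module A E]
variable {E' : Type*} [NormedAddCommGroup E'] [Module A E']

@[simp] theorem upperTriangular_fst (F : E →L[A] E) (C : E' →L[A] E) (D : E' →L[A] E')
    (z : C⋆ᵐᵒᵈ(A, E × E')) : (upperTriangular F C D z).1 = F z.1 + C z.2 := rfl

@[simp] theorem upperTriangular_snd (F : E →L[A] E) (C : E' →L[A] E) (D : E' →L[A] E')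
    (z : C⋆ᵐᵒᵈ(A, E × E')) : (upperTriangular F C D z).2 = D z.2 := rfl

/-- The operator matrix `[F 0; B D]`. -/
def lowerTriangular (F : E →L[A] E) (B : E →L[A] E') (D : E' →L[A] E') :
    C⋆ᵐᵒᵈ(A, E × E') →L[A] C⋆ᵐᵒᵈ(A, E × E') :=
  ((WithCStarModule.equivL A (A := A) (E := E × E')).symm : E × E' →L[A] C⋆ᵐᵒᵈ(A, E × E')) ∘L
    ((F ∘L ContinuousLinearMap.fst A E E').prod (B.coprod D)) ∘L
    (WithCStarModule.equivL A (A := A) (E := E × E') : C⋆ᵐᵒᵈ(A, E × E') →L[A] E × E')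

@[simp] theorem lowerTriangular_fst (F : E →L[A] E) (B : E →L[A] E') (D : E' →L[A] E')
    (z : C⋆ᵐᵒᵈ(A, E × E')) : (lowerTriangular F B D z).1 = F z.1 := rfl

@[simp] theorem lowerTriangular_snd (F : E →L[A] E) (B : E →L[A] E') (D : E' →L[A] E')
    (z : C⋆ᵐᵒᵈ(A, E × E')) : (lowerTriangular F B D z).2 = B z.1 + D z.2 := rfl

end OperatorMatrix

/-! ### Fredholm inverses and adjoints of triangular matrices. -/

section Fredholm

variable {A : Type*} [CStarAlgebra A]
variable {E : Type*} [NormedAddCommGroup E] [Module A E]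
variable {E' : Type*} [NormedAddCommGroup E'] [Module A E']

theorem IsFredholmInverse.upperTriangular {F G : E →L[A] E} {D H : E' →L[A] E'}
    (hG : IsFredholmInverse F G) (C : E' →L[A] E) (hH : IsFredholmInverse D H) :
    IsFredholmInverse (upperTriangular F C D)
      (_root_.upperTriangular G (-(G ∘L C ∘L H)) H) := by
  let ι : E × E' →ₗ[A] C⋆ᵐᵒᵈ(A, E × E') :=
    (WithCStarModule.linearEquiv A A (E × E')).symm.toLinearMap
  -- One minus inverse times matrix is `[1 - GF, -GC(1 - HD); 0, 1 - HD]`, that is, the diagonal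
  -- part followed by the shear `(u, v) ↦ (u - GCv, v)`.
  let φ : E × E' →ₗ[A] C⋆ᵐᵒᵈ(A, E × E') :=
    ι ∘ₗ (LinearMap.fst A E E' - (G ∘L C).toLinearMap ∘ₗ LinearMap.snd A E E').prod
      (LinearMap.snd A E E')
  refine ⟨fun z => ?_, ?_, ?_⟩
  · refine Prod.ext ?_ (hH.outer z.2)
    have h1 := hG.outer z.1
    have h2 := hG.outer (C (H z.2))
    have h3 := hH.outer z.2
    simp [h1, h2, h3]
  · convert (hG.fg_left.prod hH.fg_left).map φ
    ext w
    constructor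
    · rintro ⟨z, rfl⟩
      refine ⟨(z.1 - G (F z.1), z.2 - H (D z.2)), ⟨⟨z.1, rfl⟩, ⟨z.2, rfl⟩⟩, ?_⟩
      refine Prod.ext ?_ rfl
      change z.1 - G (F z.1) - G (C (z.2 - H (D z.2))) =
        z.1 - (G (F z.1 + C z.2) + -G (C (H (D z.2))))
      simp only [map_sub, map_add]
      abel
    · rintro ⟨⟨_, _⟩, ⟨⟨x, rfl⟩, ⟨y, rfl⟩⟩, rfl⟩
      refine ⟨(WithCStarModule.equiv A (E × E')).symm (x, y), Prod.ext ?_ rfl⟩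
      change x - (G (F x + C y) + -G (C (H (D y)))) = x - G (F x) - G (C (y - H (D y)))
      simp only [map_sub, map_add]
      abel
  -- In the other order the matrix is `[1 - FG, -(1 - FG)CH; 0, 1 - DH]`. Its off-diagonal entry
  -- factors through `1 - FG` on the left, so the range is the plain product.
  · convert (hG.fg_right.prod hH.fg_right).map ι
    ext w
    constructor
    · rintro ⟨z, rfl⟩
      refine ⟨(z.1 - C (H z.2) - F (G (z.1 - C (H z.2))), z.2 - D (H z.2)),
        ⟨⟨z.1 - C (H z.2), rfl⟩, ⟨z.2, rfl⟩⟩, Prod.ext ?_ rfl⟩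
      change z.1 - C (H z.2) - F (G (z.1 - C (H z.2))) =
        z.1 - (F (G z.1 + -G (C (H z.2))) + C (H z.2))
      simp only [map_sub, map_add, map_neg]
      abel
    · rintro ⟨⟨_, _⟩, ⟨⟨x, rfl⟩, ⟨y, rfl⟩⟩, rfl⟩
      -- The shift by `C (H y)` cancels the off-diagonal entry.
      refine ⟨(WithCStarModule.equiv A (E × E')).symm (x + C (H y), y), Prod.ext ?_ rfl⟩
      change x + C (H y) - (F (G (x + C (H y)) + -G (C (H y))) + C (H y)) = x - F (G x)
      simp only [map_add, map_neg]
      abel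

variable [PartialOrder A] [StarOrderedRing A]
variable {E : Type*} [NormedAddCommGroup E] [NormedSpace ℂ E] [Module A E] [CStarModule A E]
variable {E' : Type*} [NormedAddCommGroup E'] [NormedSpace ℂ E'] [Module A E'] [CStarModule A E']

theorem IsAdjointable.upperTriangular {F : E →L[A] E} {C : E' →L[A] E} {D : E' →L[A] E'}
    (hF : IsAdjointable A F) (hC : IsAdjointable A C) (hD : IsAdjointable A D) :
    IsAdjointable A (upperTriangular F C D) := by
  obtain ⟨F', hF'⟩ := hF
  obtain ⟨C', hC'⟩ := hC
  obtain ⟨D', hD'⟩ := hD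
  refine ⟨lowerTriangular F' C' D', fun x y => ?_⟩
  simp only [WithCStarModule.prod_inner, upperTriangular_fst, upperTriangular_snd,
    lowerTriangular_fst, lowerTriangular_snd, CStarModule.inner_add_left,
    CStarModule.inner_add_right, hF', hC', hD', add_assoc]

theorem upperTriangular_sub_centralScalar (F : E →L[A] E) (C : E' →L[A] E) (D : E' →L[A] E')
    (α : Subalgebra.center ℂ A) :
    upperTriangular F C D - centralScalar A C⋆ᵐᵒᵈ(A, E × E') α =
      upperTriangular (F - centralScalar A E α) C (D - centralScalar A E' α) := by
  ext z
  refine Prod.ext ?_ rfl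
  change F z.1 + C z.2 - (α : A) • z.1 = F z.1 - (α : A) • z.1 + C z.2
  abel

end Fredholm

end

theorem propositionp310 {A : Type*} [CStarAlgebra A] [PartialOrder A] [StarOrderedRing A]
    (F C D : StandardModule A →L[A] StandardModule A)
    (hF : IsAdjointable A F) (hC : IsAdjointable A C) (hD : IsAdjointable A D) :
    essentialSpectrum A (upperTriangular F C D) ⊆
      essentialSpectrum A F ∪ essentialSpectrum A D := by
  intro α hα
  by_contra hcon
  simp only [essentialSpectrum, Set.mem_union, Set.mem_ofPred_eq, not_or, not_not] at hcon hα
  rw [upperTriangular_sub_centralScalar] at hα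
  obtain ⟨G, hG⟩ := hcon.1.exists_isFredholmInverse
  obtain ⟨H, hH⟩ := hcon.2.exists_isFredholmInverse
  exact hα ((hG.upperTriangular C hH).isAFredholm (hcon.1.1.upperTriangular hC hcon.2.1))
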